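/- Let $n\ge m\ge 1$. Let $\mathbb H^n$ be the $(2n+1)$-dimensional Heisenberg group of real matrices $\begin{pmatrix}1&y&z\\0&I_n&x\\0&0&1\end{pmatrix}$ ($x$ a column and $y$ a row of $n$ real numbers, $z\in\mathbb R$), and let $\mathfrak h^n$ be its Lie algebra, identified with the right-invariant vector fields. Consider the linear system $$(\Sigma)\qquad \dot g=\mathcal X(g)+\sum_{i=1}^m u_i\,B_i(g)$$ on $\mathbb H^n$, where $\mathcal X$ is a linear vector field (a vector field whose flow is a one-parameter group of automorphisms of $\mathbb H^n$), $B_1,\dots,B_m\in\mathfrak h^n$, and the inputs $u=(u_1,\dots,u_m)$ are measurable, locally bounded and $\mathbb R^m$-valued. Let $D=-\mathrm{ad}(\mathcal X)$ be the associated derivation of $\mathfrak h^n$. Let $(X_1,Y_1,\dots,X_n,Y_n,Z)$ be a symplectic basis of $\mathfrak h^n$ (that is, a basis with $[X_i,Y_i]=Z$ for all $i$ and all other brackets zero) such that $X_i=B_i$ for $i=1,\dots,m$. Assume that $(\Sigma)$ satisfies the rank condition: the Lie subalgebra generated by $\{D^kB_i : k\ge 0,\ 1\le i\le m\}$ is $\mathfrak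 h^n$. Let $1\le j\le m$ and assume that the $j$-th cell $(B_j,Y_j)$ is decoupled, i.e. $\mathrm{Span}(B_j,Y_j,Z)$ is invariant under $D$. Let $G_j$ be the connected Lie subgroup of $\mathbb H^n$ generated by $(B_j,Y_j,Z)$, and let $(\Sigma_j)$ be the restriction of $(\Sigma)$ to $G_j$, i.e. the one-input system $\dot g=\mathcal X(g)+u_jB_j(g)$ on $G_j$. If $(\Sigma_j)$ is controllable on $G_j$ (any point of $G_j$ can be steered to any point of $G_j$ in finite time), then $(\Sigma)$ is controllable on $\mathbb H^n$. -/

import Mathlib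

open scoped ContDiff

noncomputable section

/-- The Lie algebra `𝔥ⁿ`: triples `(x, y, z)` standing for the `(n+2) × (n+2)` matrix with first row
`(0, y, z)`, last column `(z, x, 0)` and all other entries zero. -/
def HeisAlg (n : ℕ) : Type := (Fin n → ℝ) × (Fin n → ℝ) × ℝ

namespace HeisAlg

variable {n : ℕ}

instance : NormedAddCommGroup (HeisAlg n) :=
  inferInstanceAs (NormedAddCommGroup ((Fin n → ℝ) × (Fin n → ℝ) × ℝ))

instance : NormedSpace ℝ (HeisAlg n) :=
  inferInstanceAs (NormedSpace ℝ ((Fin n → ℝ) × (Fin n → ℝ) × ℝ))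

instance : FiniteDimensional ℝ (HeisAlg n) :=
  inferInstanceAs (FiniteDimensional ℝ ((Fin n → ℝ) × (Fin n → ℝ) × ℝ))

instance : CompleteSpace (HeisAlg n) :=
  inferInstanceAs (CompleteSpace ((Fin n → ℝ) × (Fin n → ℝ) × ℝ))

def mk (x y : Fin n → ℝ) (z : ℝ) : HeisAlg n := (x, y, z)

def x (A : HeisAlg n) : Fin n → ℝ := A.1
def y (A : HeisAlg n) : Fin n → ℝ := A.2.1
def z (A : HeisAlg n) : ℝ := A.2.2

@[ext] theorem ext {A B : HeisAlg n} (hx : A.x = B.x) (hy : A.y = B.y) (hz : A.z = B.z) :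
    A = B := Prod.ext hx (Prod.ext hy hz)

@[simp] theorem x_mk (a b : Fin n → ℝ) (c : ℝ) : (mk a b c).x = a := rfl
@[simp] theorem y_mk (a b : Fin n → ℝ) (c : ℝ) : (mk a b c).y = b := rfl
@[simp] theorem z_mk (a b : Fin n → ℝ) (c : ℝ) : (mk a b c).z = c := rfl
@[simp] theorem x_zero : (0 : HeisAlg n).x = 0 := rfl
@[simp] theorem y_zero : (0 : HeisAlg n).y = 0 := rfl
@[simp] theorem z_zero : (0 : HeisAlg n).z = 0 := rfl
@[simp] theorem x_add (A B : HeisAlg n) : (A + B).x = A.x + B.x := rfl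
@[simp] theorem y_add (A B : HeisAlg n) : (A + B).y = A.y + B.y := rfl
@[simp] theorem z_add (A B : HeisAlg n) : (A + B).z = A.z + B.z := rfl
@[simp] theorem x_neg (A : HeisAlg n) : (-A).x = -A.x := rfl
@[simp] theorem y_neg (A : HeisAlg n) : (-A).y = -A.y := rfl
@[simp] theorem z_neg (A : HeisAlg n) : (-A).z = -A.z := rfl
@[simp] theorem x_sub (A B : HeisAlg n) : (A - B).x = A.x - B.x := rfl
@[simp] theorem y_sub (A B : HeisAlg n) : (A - B).y = A.y - B.y := rfl
@[simp] theorem z_sub (A B : HeisAlg n) : (A - B).z = A.z - B.z := rfl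
@[simp] theorem x_smul (c : ℝ) (A : HeisAlg n) : (c • A).x = c • A.x := rfl
@[simp] theorem y_smul (c : ℝ) (A : HeisAlg n) : (c • A).y = c • A.y := rfl
@[simp] theorem z_smul (c : ℝ) (A : HeisAlg n) : (c • A).z = c • A.z := rfl

/-- The product of two matrices of `𝔥ⁿ`, which is `⟨y_A, x_B⟩` times the corner matrix. -/
def prod (A B : HeisAlg n) : HeisAlg n := mk 0 0 (A.y ⬝ᵥ B.x)

@[simp] theorem x_prod (A B : HeisAlg n) : (prod A B).x = 0 := rfl
@[simp] theorem y_prod (A B : HeisAlg n) : (prod A B).y = 0 := rfl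
@[simp] theorem z_prod (A B : HeisAlg n) : (prod A B).z = A.y ⬝ᵥ B.x := rfl

/-- The matrix represented by a triple; rows and columns are indexed by `1 + n + 1` indices. -/
def toMatrix (A : HeisAlg n) : Matrix (Unit ⊕ Fin n ⊕ Unit) (Unit ⊕ Fin n ⊕ Unit) ℝ
  | .inl _, .inr (.inl k) => A.y k
  | .inl _, .inr (.inr _) => A.z
  | .inr (.inl k), .inr (.inr _) => A.x k
  | _, _ => 0

theorem toMatrix_prod (A B : HeisAlg n) : (prod A B).toMatrix = A.toMatrix * B.toMatrix := by
  ext i j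
  rcases i with _ | _ | _ <;> rcases j with _ | _ | _ <;>
    simp [Matrix.mul_apply, toMatrix, dotProduct]

/-- The Lie bracket of the right-invariant vector fields, `[A, B] = BA - AB` on matrices. -/
instance : Bracket (HeisAlg n) (HeisAlg n) := ⟨fun A B => prod B A - prod A B⟩

theorem lie_def (A B : HeisAlg n) : ⁅A, B⁆ = prod B A - prod A B := rfl

instance : LieRing (HeisAlg n) where
  add_lie A B C := by
    ext <;> simp [lie_def, dotProduct_add, add_dotProduct]; ring
  lie_add A B C := by
    ext <;> simp [lie_def, dotProduct_add, add_dotProduct]; ring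
  lie_self A := by simp [lie_def]
  leibniz_lie A B C := by ext <;> simp [lie_def]

instance : LieAlgebra ℝ (HeisAlg n) where
  lie_smul c A B := by
    ext <;> simp [lie_def]; ring

end HeisAlg

/-- The Heisenberg group `ℍⁿ`: its elements are the matrices `g = I + G` with `G ∈ 𝔥ⁿ`. The entries
of `G` are the (global) coordinates of `g`. -/
@[ext] structure Heis (n : ℕ) where
  G : HeisAlg n

namespace Heis

variable {n : ℕ}

/-- `(I + G)(I + H) = I + (G + H + GH)`. -/
instance : Mul (Heis n) := ⟨fun g h => ⟨g.G + h.G + HeisAlg.prod g.G h.G⟩⟩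
instance : One (Heis n) := ⟨⟨0⟩⟩
/-- `(I + G)⁻¹ = I - G + G²`. -/
instance : Inv (Heis n) := ⟨fun g => ⟨-g.G + HeisAlg.prod g.G g.G⟩⟩

@[simp] theorem G_mul (g h : Heis n) : (g * h).G = g.G + h.G + HeisAlg.prod g.G h.G := rfl
@[simp] theorem G_one : (1 : Heis n).G = 0 := rfl
@[simp] theorem G_inv (g : Heis n) : (g⁻¹).G = -g.G + HeisAlg.prod g.G g.G := rfl

instance : Group (Heis n) := Group.ofLeftAxioms
  (fun a b c => by
    ext <;> simp [dotProduct_add, add_dotProduct] <;> ring)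
  (fun a => by ext <;> simp)
  (fun a => by ext <;> simp)

/-- The matrix of `g = I + G`. -/
def toMatrix (g : Heis n) : Matrix (Unit ⊕ Fin n ⊕ Unit) (Unit ⊕ Fin n ⊕ Unit) ℝ :=
  1 + g.G.toMatrix

theorem toMatrix_mul (g h : Heis n) : (g * h).toMatrix = g.toMatrix * h.toMatrix := by
  have hadd : ∀ A B : HeisAlg n, (A + B).toMatrix = A.toMatrix + B.toMatrix := by
    intro A B
    ext i j
    rcases i with _ | _ | _ <;> rcases j with _ | _ | _ <;> simp [HeisAlg.toMatrix]
  simp only [toMatrix, G_mul, hadd, HeisAlg.toMatrix_prod]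
  noncomm_ring

/-- The exponential map `𝔥ⁿ → ℍⁿ`: `exp A = I + A + A² / 2` (as `A³ = 0`). -/
def exp (A : HeisAlg n) : Heis n := ⟨A + (1 / 2 : ℝ) • HeisAlg.prod A A⟩

/-- The right-invariant vector field `g ↦ A g = A + A G`, in the global coordinates. -/
def rightInv (A : HeisAlg n) (g : Heis n) : HeisAlg n := A + HeisAlg.prod A g.G

/-- Right-invariant vector fields are affine in the coordinates. -/
theorem differentiable_rightInv (A : HeisAlg n) :
    Differentiable ℝ (fun v : HeisAlg n => rightInv A ⟨v⟩) := by
  let L : HeisAlg n →ₗ[ℝ] HeisAlg n :=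
    { toFun := fun v => HeisAlg.prod A v
      map_add' := fun v w => by ext <;> simp [dotProduct_add]
      map_smul' := fun c v => by ext <;> simp }
  exact (differentiable_const A).add (LinearMap.toContinuousLinearMap L).differentiable

/-- A smooth vector field is linear if its flow is a one-parameter group of automorphisms. -/
def IsLinearVectorField (F : Heis n → HeisAlg n) : Prop :=
  ContDiff ℝ ∞ (fun v : HeisAlg n => F ⟨v⟩) ∧
  ∃ φ : Multiplicative ℝ →* MulAut (Heis n), ∀ (g : Heis n) (t : ℝ),
    HasDerivAt (fun s : ℝ => (φ (Multiplicative.ofAdd s) g).G)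
      (F (φ (Multiplicative.ofAdd t) g)) t

/-- `D = -ad(F)`, i.e. `Y ↦ -[F, Y]`, where `[F, Y]` is the Lie bracket of vector fields and an
element of the Lie algebra is identified with its value at the identity. -/
def assocDerivation (F : Heis n → HeisAlg n) : HeisAlg n →ₗ[ℝ] HeisAlg n where
  toFun Y := -VectorField.lieBracket ℝ (fun v => F ⟨v⟩) (fun v => rightInv Y ⟨v⟩) 0
  map_add' Y Y' := by
    have h : (fun v : HeisAlg n => rightInv (Y + Y') ⟨v⟩) =
        (fun v => rightInv Y ⟨v⟩) + (fun v => rightInv Y' ⟨v⟩) := by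
      funext v
      ext <;> simp [rightInv, add_dotProduct]; ring
    rw [h, VectorField.lieBracket_add_right (differentiable_rightInv Y 0)
      (differentiable_rightInv Y' 0), neg_add]
  map_smul' c Y := by
    have h : (fun v : HeisAlg n => rightInv (c • Y) ⟨v⟩) = c • (fun v => rightInv Y ⟨v⟩) := by
      funext v
      ext <;> simp [rightInv]
    rw [h, VectorField.lieBracket_const_smul_right (differentiable_rightInv Y 0)]
    simp

/-- The connected Lie subgroup generated by a subset `S` of the Lie algebra: the subgroup generated
by the exponentials of the elements of the Lie subalgebra generated by `S`. -/
def lieSubgroup (S : Set (HeisAlg n)) : Subgroup (Heis n) :=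
  Subgroup.closure (exp '' (LieSubalgebra.lieSpan ℝ (HeisAlg n) S : Set (HeisAlg n)))

end Heis

/-- `(X₁, Y₁, …, Xₙ, Yₙ, Z)` is a symplectic basis of `𝔥ⁿ`. -/
structure IsSymplecticBasis {n : ℕ} (X Y : Fin n → HeisAlg n) (Z : HeisAlg n) : Prop where
  linearIndependent : LinearIndependent ℝ (Sum.elim X (Sum.elim Y (fun _ : Unit => Z)))
  span_eq_top : Submodule.span ℝ (Set.range (Sum.elim X (Sum.elim Y (fun _ : Unit => Z)))) = ⊤
  lie_X_Y : ∀ i, ⁅X i, Y i⁆ = Z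
  lie_X_Y_of_ne : ∀ i k, i ≠ k → ⁅X i, Y k⁆ = 0
  lie_X_X : ∀ i k, ⁅X i, X k⁆ = 0
  lie_Y_Y : ∀ i k, ⁅Y i, Y k⁆ = 0
  lie_X_Z : ∀ i, ⁅X i, Z⁆ = 0
  lie_Y_Z : ∀ i, ⁅Y i, Z⁆ = 0

/-- The linear system `ġ = F(g) + ∑ uᵢ Bᵢ(g)` on `ℍⁿ`, with `F` a linear vector field and the `Bᵢ`
right-invariant. -/
structure LinearSystem (n m : ℕ) where
  F : Heis n → HeisAlg n
  isLinear : Heis.IsLinearVectorField F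
  B : Fin m → HeisAlg n

namespace LinearSystem

variable {n m : ℕ}

/-- The derivation `D` associated to the drift. -/
def D (S : LinearSystem n m) : HeisAlg n →ₗ[ℝ] HeisAlg n := Heis.assocDerivation S.F

/-- The smallest `D`-invariant subspace containing `B₁, …, B_m`. -/
def DV (S : LinearSystem n m) : Submodule ℝ (HeisAlg n) :=
  Submodule.span ℝ {W | ∃ Y ∈ Submodule.span ℝ (Set.range S.B), ∃ k : ℕ, W = (S.D ^ k) Y}

/-- The rank condition: the Lie subalgebra generated by `DV` is the whole Lie algebra. -/
def RankCondition (S : LinearSystem n m) : Prop :=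
  LieSubalgebra.lieSpan ℝ (HeisAlg n) (S.DV : Set (HeisAlg n)) = ⊤

/-- `γ` is a trajectory on `[0, T]` for the measurable bounded input `u`: it is absolutely
continuous and satisfies the differential equation almost everywhere (in integral form). -/
structure IsTrajectory (S : LinearSystem n m) (T : ℝ) (u : ℝ → Fin m → ℝ) (γ : ℝ → Heis n) :
    Prop where
  measurable : Measurable u
  bounded : ∃ C : ℝ, ∀ t ∈ Set.Icc 0 T, ∀ i, |u t i| ≤ C
  continuousOn : ContinuousOn (fun t => (γ t).G) (Set.Icc 0 T)
  eq_integral : ∀ t ∈ Set.Icc 0 T, (γ t).G = (γ 0).G +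
    ∫ s in (0 : ℝ)..t, (S.F (γ s) + ∑ i, u s i • Heis.rightInv (S.B i) (γ s))

/-- Controllability on a subgroup `H`: any point of `H` can be steered to any point of `H` in some
finite time, along a trajectory that lies in `H`. -/
def ControllableOn (S : LinearSystem n m) (H : Subgroup (Heis n)) : Prop :=
  ∀ g ∈ H, ∀ h ∈ H, ∃ T : ℝ, 0 ≤ T ∧ ∃ (u : ℝ → Fin m → ℝ) (γ : ℝ → Heis n),
    S.IsTrajectory T u γ ∧ γ 0 = g ∧ γ T = h ∧ ∀ t ∈ Set.Icc 0 T, γ t ∈ H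

/-- Controllability on the whole group `ℍⁿ`. -/
def Controllable (S : LinearSystem n m) : Prop := S.ControllableOn ⊤

/-- The `j`-th cell `(B_j, Y_j)` is decoupled: the span of `(B_j, Y_j, Z)` is `D`-invariant. -/
def CellDecoupled (S : LinearSystem n m) (j : Fin m) (Yj Z : HeisAlg n) : Prop :=
  ∀ W ∈ Submodule.span ℝ {S.B j, Yj, Z}, S.D W ∈ Submodule.span ℝ {S.B j, Yj, Z}

/-- The one-input system `ġ = F(g) + u_j B_j(g)`. When the `j`-th cell is decoupled, its vector
fields are tangent to the subgroup `G_j` generated by `(B_j, Y_j, Z)`. -/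
def cellSystem (S : LinearSystem n m) (j : Fin m) : LinearSystem n 1 where
  F := S.F
  isLinear := S.isLinear
  B := fun _ => S.B j

/-- The system obtained by restriction to the subgroup `G_j` generated by `(B_j, Y_j, Z)` is
controllable on `G_j`. -/
def CellControllable (S : LinearSystem n m) (j : Fin m) (Yj Z : HeisAlg n) : Prop :=
  (S.cellSystem j).ControllableOn (Heis.lieSubgroup {S.B j, Yj, Z})

end LinearSystem

end

/-! Modulo the center, the system becomes a linear control system on `ℝ²ⁿ`. Brackets in `𝔥ⁿ` are
central, so they contribute nothing to the quotient, and the rank condition becomes Kalman's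
condition there (`RankCondition.span_eq_top`). By Kalman's theorem (`exists_steering`) the quotient
system can be steered from any point to any other.

Such a quotient trajectory lifts to `ℍⁿ` for every initial corner coordinate `z`. The corner
coordinate solves a scalar equation `ζ' = l ζ + r(t)`, where `r` depends only on the quotient
trajectory, so it ends at `a z + c` with `a = exp l ≠ 0` (`exists_steering_affine`). Hence every `g`
can be steered to some central element and, since `a` is invertible, every `h` can be reached from
some central element.

It remains to move between two central elements (`controllable_of_steerable_center`). The whole
center lies in `G_j`, because `Z` spans it, so controllability of the cell system does this, with
all inputs other than `u_j` set to zero. -/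

noncomputable section

/-! ### Kalman's theorem for linear control systems on a finite-dimensional space. -/

section Kalman

variable {E ι : Type*} [NormedAddCommGroup E] [NormedSpace ℝ E]

theorem continuous_exp_neg_smul [CompleteSpace E] (A : E →L[ℝ] E) :
    Continuous fun s : ℝ => NormedSpace.exp ((-s) • A) := by
  let _ : NormedAlgebra ℚ (E →L[ℝ] E) := NormedAlgebra.restrictScalars ℚ ℝ _
  exact NormedSpace.exp_continuous.comp (by fun_prop)

theorem exp_smul_exp_smul_of_add_eq_zero [CompleteSpace E] (A : E →L[ℝ] E) {s t : ℝ}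
    (h : s + t = 0) (v : E) :
    NormedSpace.exp (s • A) (NormedSpace.exp (t • A) v) = v := by
  let _ : NormedAlgebra ℚ (E →L[ℝ] E) := NormedAlgebra.restrictScalars ℚ ℝ _
  rw [← mul_apply_eq_comp, ← NormedSpace.exp_add_of_commute
    (((Commute.refl A).smul_left _).smul_right _), ← add_smul, h]
  simp

variable [FiniteDimensional ℝ E] [Fintype ι]

/-- Variation of constants: the solution of `w' = A w + r` with `w 0 = w₀`. -/
theorem hasDerivAt_exp_smul_add_integral (A : E →L[ℝ] E) (r : ℝ → E) (hr : Continuous r) (w₀ : E)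
    (t : ℝ) :
    HasDerivAt
      (fun t : ℝ => NormedSpace.exp (t • A)
        (w₀ + ∫ s in (0 : ℝ)..t, NormedSpace.exp ((-s) • A) (r s)))
      (A (NormedSpace.exp (t • A) (w₀ + ∫ s in (0 : ℝ)..t, NormedSpace.exp ((-s) • A) (r s)))
        + r t) t := by
  have : CompleteSpace E := FiniteDimensional.complete ℝ E
  have h1 := hasDerivAt_exp_smul_const' A t
  have hcexp := continuous_exp_neg_smul A
  have hc : Continuous fun s : ℝ => NormedSpace.exp ((-s) • A) (r s) := hcexp.clm_apply hr
  have h2 := (hc.integral_hasStrictDerivAt 0 t).hasDerivAt.const_add w₀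
  convert h1.clm_apply h2 using 1
  simp only [mul_apply_eq_comp]
  rw [exp_smul_exp_smul_of_add_eq_zero A (by ring) (r t)]

/-- The endpoint map at time `1`, pulled back to time `0`, of the linear control system
`w' = A w + ∑ uᵢ bᵢ` is onto under Kalman's condition. -/
theorem exists_control_integral_eq (A : E →L[ℝ] E) (b : ι → E)
    (h : Submodule.span ℝ {v | ∃ i, ∃ k : ℕ, v = (A ^ k) (b i)} = ⊤) (v : E) :
    ∃ u : ℝ → ι → ℝ, Continuous u ∧
      ∫ s in (0 : ℝ)..1, NormedSpace.exp ((-s) • A) (∑ i, u s i • b i) = v := by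
  have : CompleteSpace E := FiniteDimensional.complete ℝ E
  have hcexp := continuous_exp_neg_smul A
  have hcont : ∀ u : ℝ → ι → ℝ, Continuous u →
      Continuous fun s : ℝ => NormedSpace.exp ((-s) • A) (∑ i, u s i • b i) :=
    fun u hu => hcexp.clm_apply (by fun_prop)
  let Φ : C(ℝ, ι → ℝ) →ₗ[ℝ] E :=
    { toFun := fun u => ∫ s in (0 : ℝ)..1, NormedSpace.exp ((-s) • A) (∑ i, u s i • b i)
      map_add' := fun u u' => by
        rw [← intervalIntegral.integral_add ((hcont u u.continuous).intervalIntegrable _ _)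
          ((hcont u' u'.continuous).intervalIntegrable _ _)]
        simp only [ContinuousMap.add_apply, Pi.add_apply, add_smul, Finset.sum_add_distrib, map_add]
      map_smul' := fun c u => by
        rw [RingHom.id_apply, ← intervalIntegral.integral_smul]
        simp only [ContinuousMap.smul_apply, Pi.smul_apply, smul_assoc, ← Finset.smul_sum, map_smul] }
  suffices hΦ : LinearMap.range Φ = ⊤ by
    obtain ⟨u, hu⟩ := (LinearMap.range_eq_top.1 hΦ) v
    exact ⟨u, u.continuous, hu⟩
  by_contra hne
  -- Duality: a proper range is annihilated by a nonzero functional `f`.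
  obtain ⟨f, hf, hle⟩ := Submodule.exists_le_ker_of_lt_top _ (lt_top_iff_ne_top.2 hne)
  let fc : E →L[ℝ] ℝ := LinearMap.toContinuousLinearMap f
  have hcf : ∀ v : E, Continuous fun s : ℝ => fc (NormedSpace.exp ((-s) • A) v) :=
    fun v => fc.continuous.comp (hcexp.clm_apply continuous_const)
  have hzero : ∀ i, ∀ s ∈ Set.Icc (0 : ℝ) 1, fc (NormedSpace.exp ((-s) • A) (b i)) = 0 := by
    -- Testing `f` on the control made of its own observations `f (exp (-sA) bᵢ)` gives an integral
    -- of a sum of squares, which must vanish.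
    let u : C(ℝ, ι → ℝ) := ⟨fun s i => fc (NormedSpace.exp ((-s) • A) (b i)),
      continuous_pi fun i => hcf (b i)⟩
    have hu : fc (Φ u) = 0 := hle ⟨u, rfl⟩
    have hint : ∫ s in (0 : ℝ)..1, ∑ i, fc (NormedSpace.exp ((-s) • A) (b i)) ^ 2 = 0 := by
      refine Eq.trans ?_ hu
      change _ = fc (∫ s in (0 : ℝ)..1, NormedSpace.exp ((-s) • A) (∑ i, u s i • b i))
      rw [← ContinuousLinearMap.intervalIntegral_comp_comm _
        ((hcont u u.continuous).intervalIntegrable _ _)]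
      simp [u, map_sum, sq]
    intro i s hs
    by_contra hsi
    have hpos : 0 < ∫ s in (0 : ℝ)..1, ∑ i, fc (NormedSpace.exp ((-s) • A) (b i)) ^ 2 := by
      refine intervalIntegral.integral_pos one_pos ?_ ?_ ⟨s, hs, ?_⟩
      · exact (continuous_finsetSum _ fun i _ => (hcf (b i)).pow 2).continuousOn
      · exact fun s _ => Finset.sum_nonneg fun i _ => sq_nonneg _
      · exact Finset.sum_pos' (fun i _ => sq_nonneg _) ⟨i, Finset.mem_univ _, by positivity⟩
    exact hpos.ne' hint
  have hder : ∀ (v : E) (s : ℝ), HasDerivAt (fun s : ℝ => fc (NormedSpace.exp ((-s) • A) v))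
      (-fc (NormedSpace.exp ((-s) • A) (A v))) s := by
    intro v s
    have h1 := (hasDerivAt_exp_smul_const A (-s)).scomp s (hasDerivAt_neg s)
    have h2 := fc.hasFDerivAt.comp_hasDerivAt s (h1.clm_apply (hasDerivAt_const s v))
    simpa [Function.comp_def] using h2
  have hzero' : ∀ i (k : ℕ), ∀ s ∈ Set.Ioo (0 : ℝ) 1,
      fc (NormedSpace.exp ((-s) • A) ((A ^ k) (b i))) = 0 := by
    intro i k
    induction k with
    | zero => exact fun s hs => by simpa using hzero i s ⟨hs.1.le, hs.2.le⟩
    | succ k ih =>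
      intro s hs
      -- Each derivative in `s` brings out one more factor `A`; the open interval makes the
      -- vanishing hold near `s`.
      have h0 : HasDerivAt (fun s : ℝ => fc (NormedSpace.exp ((-s) • A) ((A ^ k) (b i)))) 0 s :=
        (hasDerivAt_const s (0 : ℝ)).congr_of_eventuallyEq
          (Filter.eventually_of_mem (Ioo_mem_nhds hs.1 hs.2) ih)
      have := (hder ((A ^ k) (b i)) s).unique h0
      rw [pow_succ', mul_apply_eq_comp]
      linarith
  -- Any interior time would do; the exponential there is invertible, so `f` itself vanishes.
  have hcomp : (fc ∘L NormedSpace.exp ((-(1 / 2 : ℝ)) • A) : E →L[ℝ] ℝ).toLinearMap = 0 := by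
    refine LinearMap.ext_on h ?_
    rintro _ ⟨i, k, rfl⟩
    exact hzero' i k (1 / 2) ⟨by norm_num, by norm_num⟩
  apply hf
  ext v
  have := LinearMap.congr_fun hcomp (NormedSpace.exp ((1 / 2 : ℝ) • A) v)
  have hinv : NormedSpace.exp ((-(1 / 2 : ℝ)) • A) (NormedSpace.exp ((1 / 2 : ℝ) • A) v) = v :=
    exp_smul_exp_smul_of_add_eq_zero A (by norm_num) v
  rw [ContinuousLinearMap.coe_coe, ContinuousLinearMap.comp_apply, hinv] at this
  exact this

/-- Kalman's theorem: a linear control system satisfying the rank condition can be steered between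
any two points, in time `1` and with a continuous control. -/
theorem exists_steering (A : E →L[ℝ] E) (b : ι → E)
    (h : Submodule.span ℝ {v | ∃ i, ∃ k : ℕ, v = (A ^ k) (b i)} = ⊤) (w₀ w₁ : E) :
    ∃ u : ℝ → ι → ℝ, Continuous u ∧ ∃ w : ℝ → E, w 0 = w₀ ∧ w 1 = w₁ ∧
      ∀ t, HasDerivAt w (A (w t) + ∑ i, u t i • b i) t := by
  have : CompleteSpace E := FiniteDimensional.complete ℝ E
  -- By variation of constants, `w 1 = exp A (w₀ + integral)`; this is the value of the integral
  -- that gives `w₁`.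
  obtain ⟨u, hu, hint⟩ := exists_control_integral_eq A b h
    (NormedSpace.exp ((-1 : ℝ) • A) w₁ - w₀)
  refine ⟨u, hu, _, ?_, ?_, hasDerivAt_exp_smul_add_integral A _ (by fun_prop) w₀⟩
  · simp
  · rw [hint, add_sub_cancel, exp_smul_exp_smul_of_add_eq_zero A (by norm_num)]

end Kalman

/-! ### Splitting `𝔥ⁿ` into its center and a complement. -/

namespace HeisAlg

variable {n : ℕ}

/-- The product of matrices of `𝔥ⁿ` as a continuous bilinear map. -/
def prodL (n : ℕ) : HeisAlg n →L[ℝ] HeisAlg n →L[ℝ] HeisAlg n :=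
  LinearMap.toContinuousBilinearMap <| LinearMap.mk₂ ℝ prod
    (fun A A' B => by ext <;> simp [add_dotProduct])
    (fun c A B => by ext <;> simp)
    (fun A B B' => by ext <;> simp [dotProduct_add])
    (fun c A B => by ext <;> simp)

@[simp] theorem prodL_apply (A B : HeisAlg n) : prodL n A B = prod A B := rfl

/-- The projection of `𝔥ⁿ` onto its quotient by the center. -/
def proj (n : ℕ) : HeisAlg n →L[ℝ] (Fin n → ℝ) × (Fin n → ℝ) :=
  LinearMap.toContinuousLinearMap
    { toFun := fun A => (A.x, A.y), map_add' := fun _ _ => rfl, map_smul' := fun _ _ => rfl }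

/-- The corner coordinate. -/
def corner (n : ℕ) : HeisAlg n →L[ℝ] ℝ :=
  LinearMap.toContinuousLinearMap
    { toFun := fun A => A.z, map_add' := fun _ _ => rfl, map_smul' := fun _ _ => rfl }

/-- The section `w ↦ (w, 0)` of `proj`. -/
def lift (n : ℕ) : (Fin n → ℝ) × (Fin n → ℝ) →L[ℝ] HeisAlg n :=
  LinearMap.toContinuousLinearMap
    { toFun := fun w => mk w.1 w.2 0
      map_add' := fun _ _ => by ext <;> simp
      map_smul' := fun _ _ => by ext <;> simp }

/-- The inclusion of the center. -/
def center (n : ℕ) : ℝ →L[ℝ] HeisAlg n :=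
  LinearMap.toContinuousLinearMap
    { toFun := fun c => mk 0 0 c
      map_add' := fun _ _ => by ext <;> simp
      map_smul' := fun _ _ => by ext <;> simp }

@[simp] theorem proj_apply (A : HeisAlg n) : proj n A = (A.x, A.y) := rfl
@[simp] theorem corner_apply (A : HeisAlg n) : corner n A = A.z := rfl
@[simp] theorem lift_apply (w : (Fin n → ℝ) × (Fin n → ℝ)) : lift n w = mk w.1 w.2 0 := rfl
@[simp] theorem center_apply (c : ℝ) : center n c = mk 0 0 c := rfl

theorem lift_proj_add_center_corner (A : HeisAlg n) :
    lift n (proj n A) + center n (corner n A) = A := by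
  ext <;> simp

theorem proj_lie (A B : HeisAlg n) : proj n ⁅A, B⁆ = 0 := by
  simp [lie_def]

end HeisAlg

/-! ### Linear vector fields: the induced maps on the center and on the quotient by it. -/

namespace Heis

open HeisAlg

variable {n : ℕ} {F : Heis n → HeisAlg n}

namespace IsLinearVectorField

/-- Differentiate `φ_t (g h) = φ_t g · φ_t h` at `t = 0`; the bilinear term of the group law obeys
the Leibniz rule. -/
theorem map_mul (hF : IsLinearVectorField F) (g h : Heis n) :
    F (g * h) = F g + F h + (prod g.G (F h) + prod (F g) h.G) := by
  obtain ⟨φ, hφ⟩ := hF.2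
  have h0 : ∀ g : Heis n, HasDerivAt (fun s : ℝ => (φ (Multiplicative.ofAdd s) g).G) (F g) 0 := by
    intro g
    simpa using hφ g 0
  have hgh := h0 (g * h)
  simp only [_root_.map_mul, G_mul] at hgh
  have := ((h0 g).add (h0 h)).add ((prodL n).hasDerivAt_of_bilinear (fun _ => h0 g) (fun _ => h0 h))
  simpa using hgh.unique this

theorem continuous (hF : IsLinearVectorField F) : Continuous fun v : HeisAlg n => F ⟨v⟩ :=
  hF.1.continuous

theorem map_one (hF : IsLinearVectorField F) : F 1 = 0 := by
  have h := hF.map_mul 1 1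
  have h0 : prod (0 : HeisAlg n) (F 1) + prod (F 1) 0 = 0 := by ext <;> simp
  rw [mul_one, G_one, h0, add_zero] at h
  exact left_eq_add.1 h

theorem proj_mul (hF : IsLinearVectorField F) (g h : Heis n) :
    proj n (F (g * h)) = proj n (F g) + proj n (F h) := by
  rw [hF.map_mul]
  simp

/-- Central elements are commutators, so that they do not contribute to the projection. -/
theorem proj_center [Nonempty (Fin n)] (hF : IsLinearVectorField F) (c : ℝ) :
    proj n (F ⟨center n c⟩) = 0 := by
  obtain ⟨i⟩ := ‹Nonempty (Fin n)›
  -- The elements with `x = c eᵢ` and with `y = eᵢ` commute up to the central element `c`, and an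
  -- additive map cannot see the order.
  have h : (⟨center n c⟩ : Heis n) *
      (⟨HeisAlg.mk (Pi.single i c) 0 0⟩ * ⟨HeisAlg.mk 0 (Pi.single i 1) 0⟩) =
      ⟨HeisAlg.mk 0 (Pi.single i 1) 0⟩ * ⟨HeisAlg.mk (Pi.single i c) 0 0⟩ := by
    ext <;> simp
  have := congrArg (fun g => proj n (F g)) h
  simp only [hF.proj_mul] at this
  rw [add_comm (proj n (F ⟨HeisAlg.mk 0 (Pi.single i 1) 0⟩))] at this
  exact add_eq_right.1 this

theorem mk_eq_lift_mul_center (v : HeisAlg n) :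
    (⟨v⟩ : Heis n) = ⟨lift n (proj n v)⟩ * ⟨center n (corner n v)⟩ := by
  ext <;> simp

/-- The linear map induced on the quotient by the center. -/
def quotientMap [Nonempty (Fin n)] (hF : IsLinearVectorField F) :
    (Fin n → ℝ) × (Fin n → ℝ) →L[ℝ] (Fin n → ℝ) × (Fin n → ℝ) :=
  -- The section `lift` is multiplicative up to a central factor, which `proj ∘ F` ignores;
  -- continuity upgrades additivity to linearity.
  AddMonoidHom.toRealLinearMap
    (AddMonoidHom.mk' (fun w => proj n (F ⟨lift n w⟩)) fun w w' => by
      have h : (⟨lift n w⟩ : Heis n) * ⟨lift n w'⟩ =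
          ⟨lift n (w + w')⟩ * ⟨center n (w.2 ⬝ᵥ w'.1)⟩ := by
        ext <;> simp
      have := congrArg (fun g => proj n (F g)) h
      simpa only [hF.proj_mul, hF.proj_center, add_zero] using this.symm)
    ((proj n).continuous.comp (hF.continuous.comp (lift n).continuous))

theorem proj_apply [Nonempty (Fin n)] (hF : IsLinearVectorField F) (v : HeisAlg n) :
    proj n (F ⟨v⟩) = hF.quotientMap (proj n v) := by
  rw [mk_eq_lift_mul_center, hF.proj_mul, hF.proj_center, add_zero]
  rfl

/-- The eigenvalue of the linear vector field on the center. -/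
theorem exists_corner_center [Nonempty (Fin n)] (hF : IsLinearVectorField F) :
    ∃ l : ℝ, ∀ c, corner n (F ⟨center n c⟩) = l * c := by
  let f : ℝ →L[ℝ] ℝ := AddMonoidHom.toRealLinearMap
    (AddMonoidHom.mk' (fun c => corner n (F ⟨center n c⟩)) fun c c' => by
      have h : (⟨center n (c + c')⟩ : Heis n) = ⟨center n c⟩ * ⟨center n c'⟩ := by
        ext <;> simp
      rw [h, hF.map_mul]
      simp)
    ((corner n).continuous.comp (hF.continuous.comp (center n).continuous))
  refine ⟨f 1, fun c => ?_⟩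
  have : f c = c * f 1 := by simpa using f.map_smul c 1
  rw [mul_comm, ← this]
  rfl

/-- The field is central at central points, so the bilinear terms of `map_mul` vanish in the
splitting of `v`. -/
theorem corner_apply [Nonempty (Fin n)] (hF : IsLinearVectorField F) {l : ℝ}
    (hl : ∀ c, corner n (F ⟨center n c⟩) = l * c) (v : HeisAlg n) :
    corner n (F ⟨v⟩) = corner n (F ⟨lift n (proj n v)⟩) + l * corner n v := by
  have h0 := hF.proj_center (corner n v)
  rw [HeisAlg.proj_apply, Prod.mk_eq_zero] at h0
  rw [mk_eq_lift_mul_center, hF.map_mul, ← hl, map_add, map_add]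
  simp at h0
  simp [h0]

/-- Since `F` vanishes at the identity, the bracket there reduces to the differential of `F`, whose
projection comes from the linear map `proj ∘ F`. -/
theorem proj_assocDerivation [Nonempty (Fin n)] (hF : IsLinearVectorField F) (W : HeisAlg n) :
    proj n (assocDerivation F W) = hF.quotientMap (proj n W) := by
  have hd : DifferentiableAt ℝ (fun v : HeisAlg n => F ⟨v⟩) 0 :=
    (hF.1.differentiable (by simp)) 0
  have h1 : assocDerivation F W = fderiv ℝ (fun v : HeisAlg n => F ⟨v⟩) 0 W := by
    change -VectorField.lieBracket ℝ (fun v => F ⟨v⟩) (fun v => rightInv W ⟨v⟩) 0 = _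
    have hF1 : F ⟨0⟩ = 0 := hF.map_one
    have hW : rightInv W ⟨0⟩ = W := by ext <;> simp [rightInv]
    rw [VectorField.lieBracket_eq]
    simp [hF1, hW]
  have h2 := (proj n).hasFDerivAt.comp (0 : HeisAlg n) hd.hasFDerivAt
  have h3 : HasFDerivAt (fun v : HeisAlg n => proj n (F ⟨v⟩)) (hF.quotientMap ∘L proj n) 0 := by
    simp only [hF.proj_apply]
    exact (hF.quotientMap ∘L proj n).hasFDerivAt
  rw [h1]
  exact DFunLike.congr_fun (h2.unique h3) W

end IsLinearVectorField

end Heis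

/-! ### From the rank condition to Kalman's condition on the quotient. -/

namespace LinearSystem

open HeisAlg

variable {n m : ℕ} [Nonempty (Fin n)] {S : LinearSystem n m}

theorem proj_D_pow (S : LinearSystem n m) (k : ℕ) (W : HeisAlg n) :
    proj n ((S.D ^ k) W) = (S.isLinear.quotientMap ^ k) (proj n W) := by
  induction k with
  | zero => rfl
  | succ k ih =>
    rw [pow_succ', pow_succ', Module.End.mul_apply, mul_apply_eq_comp, ← ih]
    exact S.isLinear.proj_assocDerivation _

/-- The rank condition implies Kalman's condition on the quotient by the center. -/
theorem RankCondition.span_eq_top (hS : S.RankCondition) :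
    Submodule.span ℝ {v | ∃ i, ∃ k : ℕ, v = (S.isLinear.quotientMap ^ k) (proj n (S.B i))} = ⊤ := by
  set p := Submodule.span ℝ
    {v | ∃ i, ∃ k : ℕ, v = (S.isLinear.quotientMap ^ k) (proj n (S.B i))} with hp
  -- The preimage of any subspace of the quotient is a Lie subalgebra, since it contains all
  -- brackets.
  let K : LieSubalgebra ℝ (HeisAlg n) :=
    { p.comap (proj n).toLinearMap with
      lie_mem' := fun {A B} _ _ => by
        change proj n ⁅A, B⁆ ∈ p
        rw [proj_lie]
        exact p.zero_mem }
  have hK : K = ⊤ := by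
    rw [eq_top_iff, ← hS, LieSubalgebra.lieSpan_le]
    change S.DV ≤ p.comap (proj n).toLinearMap
    refine Submodule.span_le.2 ?_
    rintro _ ⟨W, hW, k, rfl⟩
    change proj n ((S.D ^ k) W) ∈ p
    rw [proj_D_pow]
    induction hW using Submodule.span_induction with
    | mem W hW =>
      obtain ⟨i, rfl⟩ := hW
      exact Submodule.subset_span ⟨i, k, rfl⟩
    | zero => simpa only [map_zero] using p.zero_mem
    | add W W' _ _ h h' => simpa only [map_add] using p.add_mem h h'
    | smul c W _ h => simpa only [map_smul] using p.smul_mem c h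
  rw [eq_top_iff]
  intro w _
  have : lift n w ∈ K := hK ▸ LieSubalgebra.mem_top _
  exact this

end LinearSystem

namespace Heis

open HeisAlg

variable {n : ℕ}

theorem exp_center (c : ℝ) : exp (center n c) = ⟨center n c⟩ := by
  ext <;> simp [exp]

end Heis

/-! ### Trajectories: integrability, concatenation, lifting from the quotient. -/

namespace LinearSystem

open HeisAlg

variable {n m : ℕ} {S : LinearSystem n m}

/-- The right-hand side of the differential equation along a curve. -/
def velocity (S : LinearSystem n m) (u : ℝ → Fin m → ℝ) (γ : ℝ → Heis n) (t : ℝ) : HeisAlg n :=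
  S.F (γ t) + ∑ i, u t i • Heis.rightInv (S.B i) (γ t)

theorem continuousOn_F_comp {γ : ℝ → Heis n} {s : Set ℝ}
    (hγ : ContinuousOn (fun t => (γ t).G) s) : ContinuousOn (fun t => S.F (γ t)) s :=
  S.isLinear.continuous.comp_continuousOn hγ

theorem continuousOn_rightInv_comp (A : HeisAlg n) {γ : ℝ → Heis n} {s : Set ℝ}
    (hγ : ContinuousOn (fun t => (γ t).G) s) : ContinuousOn (fun t => Heis.rightInv A (γ t)) s :=
  continuousOn_const.add ((prodL n A).continuous.comp_continuousOn hγ)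

theorem IsTrajectory.intervalIntegrable {T : ℝ} {u : ℝ → Fin m → ℝ} {γ : ℝ → Heis n}
    (h : S.IsTrajectory T u γ) (hT : 0 ≤ T) :
    IntervalIntegrable (S.velocity u γ) MeasureTheory.volume 0 T := by
  have hI : Set.uIcc 0 T = Set.Icc 0 T := Set.uIcc_of_le hT
  obtain ⟨C, hC⟩ := h.bounded
  refine ((continuousOn_F_comp h.continuousOn).mono hI.le).intervalIntegrable.add ?_
  have hs : ∀ i, IntervalIntegrable (fun t => u t i • Heis.rightInv (S.B i) (γ t))
      MeasureTheory.volume 0 T := by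
    intro i
    refine IntervalIntegrable.smul_continuousOn ?_
      ((continuousOn_rightInv_comp _ h.continuousOn).mono hI.le)
    rw [intervalIntegrable_iff_integrableOn_Icc_of_le hT]
    refine MeasureTheory.IntegrableOn.of_bound measure_Icc_lt_top
      ((measurable_pi_iff.1 h.measurable i).aestronglyMeasurable) C ?_
    exact (MeasureTheory.ae_restrict_iff' measurableSet_Icc).2
      (Filter.Eventually.of_forall fun t ht => hC t ht i)
  have := IntervalIntegrable.sum Finset.univ (fun i _ => hs i)
  simpa only [Finset.sum_fn] using this

/-- A curve solving the equation with a continuous control everywhere is a trajectory. -/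
theorem isTrajectory_of_hasDerivAt {u : ℝ → Fin m → ℝ} {γ : ℝ → Heis n} (T : ℝ)
    (hu : Continuous u) (hγ : ∀ t, HasDerivAt (fun t => (γ t).G) (S.velocity u γ t) t) :
    S.IsTrajectory T u γ := by
  have hc : Continuous fun t => (γ t).G :=
    continuous_iff_continuousAt.2 fun t => (hγ t).continuousAt
  have hv : Continuous (S.velocity u γ) := by
    refine (S.isLinear.continuous.comp hc).add (continuous_finsetSum _ fun i _ => ?_)
    exact ((continuous_apply i).comp hu).smul
      (continuous_const.add ((prodL n (S.B i)).continuous.comp hc))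
  refine ⟨hu.measurable, ?_, hc.continuousOn, fun t _ => ?_⟩
  · obtain ⟨C, hC⟩ := isCompact_Icc.exists_bound_of_continuousOn (hu.continuousOn (s := Set.Icc 0 T))
    exact ⟨C, fun t ht i => (norm_le_pi_norm (u t) i).trans (hC t ht)⟩
  · have := intervalIntegral.integral_eq_sub_of_hasDerivAt (fun t _ => hγ t)
      (hv.intervalIntegrable 0 t)
    change _ = _ + ∫ s in (0 : ℝ)..t, S.velocity u γ s
    rw [this, add_sub_cancel]

/-- `g` can be steered to `h`. -/
def Steerable (S : LinearSystem n m) (g h : Heis n) : Prop :=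
  ∃ T : ℝ, 0 ≤ T ∧ ∃ (u : ℝ → Fin m → ℝ) (γ : ℝ → Heis n),
    S.IsTrajectory T u γ ∧ γ 0 = g ∧ γ T = h

/-- Concatenation: run the first trajectory up to time `T`, then the second with time shifted by
`T`. -/
theorem Steerable.trans {g h k : Heis n} (hgh : S.Steerable g h) (hhk : S.Steerable h k) :
    S.Steerable g k := by
  obtain ⟨T, hT, u, γ, hγ, h0, h1⟩ := hgh
  obtain ⟨T', hT', u', γ', hγ', h0', h1'⟩ := hhk
  let v : ℝ → Fin m → ℝ := fun t => if t ≤ T then u t else u' (t - T)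
  let δ : ℝ → Heis n := fun t => if t ≤ T then γ t else γ' (t - T)
  have hδ : ∀ t, T ≤ t → δ t = γ' (t - T) := by
    intro t ht
    rcases ht.eq_or_lt with rfl | ht
    · simp [δ, h1, h0']
    · simp [δ, ht.not_ge]
  have hvel : ∀ t ≤ T, S.velocity v δ t = S.velocity u γ t := by
    intro t ht
    simp [velocity, v, δ, ht]
  -- The inequality is strict because the two inputs may differ at the junction; one point does not
  -- affect the integral.
  have hvel' : ∀ t, T < t → S.velocity v δ t = S.velocity u' γ' (t - T) := by
    intro t ht
    simp [velocity, v, δ, ht.not_ge]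
  have hmaps : Set.MapsTo (fun t => t - T) (Set.Icc T (T + T')) (Set.Icc 0 T') := by
    intro t ht
    exact ⟨by linarith [ht.1], by linarith [ht.2]⟩
  have hcong : ∀ t, 0 ≤ t → t ≤ T →
      ∫ s in (0 : ℝ)..t, S.velocity v δ s = ∫ s in (0 : ℝ)..t, S.velocity u γ s := by
    intro t ht0 ht
    refine intervalIntegral.integral_congr fun s hs => hvel s ?_
    rw [Set.uIcc_of_le ht0] at hs
    exact hs.2.trans ht
  refine ⟨T + T', add_nonneg hT hT', v, δ, ⟨?_, ?_, ?_, ?_⟩, by simp [δ, hT, h0], ?_⟩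
  · exact Measurable.ite measurableSet_Iic hγ.measurable
      (hγ'.measurable.comp (measurable_id.sub_const T))
  · obtain ⟨C, hC⟩ := hγ.bounded
    obtain ⟨C', hC'⟩ := hγ'.bounded
    refine ⟨max C C', fun t ht i => ?_⟩
    by_cases htT : t ≤ T
    · simpa [v, htT] using Or.inl (hC t ⟨ht.1, htT⟩ i)
    · simpa [v, htT] using Or.inr (hC' (t - T) (hmaps ⟨(not_le.1 htT).le, ht.2⟩) i)
  · rw [← Set.Icc_union_Icc_eq_Icc hT (le_add_of_nonneg_right hT')]
    refine ContinuousOn.union_of_isClosed ?_ ?_ isClosed_Icc isClosed_Icc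
    · exact hγ.continuousOn.congr fun t ht => by simp [δ, ht.2]
    · refine (hγ'.continuousOn.comp (by fun_prop) hmaps).congr fun t ht => ?_
      simp [hδ t ht.1]
  · intro t ht
    have hδ0 : δ 0 = γ 0 := by simp [δ, hT]
    change (δ t).G = (δ 0).G + ∫ s in (0 : ℝ)..t, S.velocity v δ s
    rcases le_total t T with htT | htT
    · rw [hcong t ht.1 htT, hδ0]
      simpa [δ, htT, velocity] using hγ.eq_integral t ⟨ht.1, htT⟩
    · have hmem := hmaps ⟨htT, ht.2⟩
      have hI := hγ.intervalIntegrable hT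
      have hI' : IntervalIntegrable (fun s => S.velocity u' γ' (s - T)) MeasureTheory.volume T t := by
        have hle : Set.uIcc 0 (t - T) ⊆ Set.uIcc 0 T' := by
          rw [Set.uIcc_of_le hmem.1, Set.uIcc_of_le hT']
          exact Set.Icc_subset_Icc_right hmem.2
        have := ((hγ'.intervalIntegrable hT').mono_set hle).comp_sub_right T
        simpa using this
      have hcong' : Set.EqOn (fun s => S.velocity u' γ' (s - T)) (S.velocity v δ) (Set.uIoc T t) := by
        intro s hs
        rw [Set.uIoc_of_le htT] at hs
        exact (hvel' s hs.1).symm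
      have hcong0 : Set.EqOn (S.velocity u γ) (S.velocity v δ) (Set.uIoc 0 T) := by
        intro s hs
        rw [Set.uIoc_of_le hT] at hs
        exact (hvel s hs.2).symm
      rw [← intervalIntegral.integral_add_adjacent_intervals (hI.congr hcong0) (hI'.congr hcong'),
        hcong T hT le_rfl,
        ← intervalIntegral.integral_congr_ae (Filter.Eventually.of_forall hcong'),
        intervalIntegral.integral_comp_sub_right (S.velocity u' γ') T, sub_self, ← add_assoc, hδ0,
        hδ t htT]
      have e1 : (γ T).G = (γ 0).G + ∫ s in (0 : ℝ)..T, S.velocity u γ s :=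
        hγ.eq_integral T ⟨hT, le_rfl⟩
      rw [← e1, h1, ← h0']
      exact hγ'.eq_integral _ hmem
  · simp [hδ (T + T') (le_add_of_nonneg_right hT'), h1']

/-- A trajectory of a one-input subsystem is a trajectory of the whole system. -/
theorem IsTrajectory.of_cellSystem {j : Fin m} {T : ℝ} {u : ℝ → Fin 1 → ℝ} {γ : ℝ → Heis n}
    (h : (S.cellSystem j).IsTrajectory T u γ) :
    S.IsTrajectory T (fun t => Pi.single j (u t 0)) γ := by
  refine ⟨?_, ?_, h.continuousOn, fun t ht => ?_⟩
  · refine measurable_pi_iff.2 fun i => ?_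
    have h0 := measurable_pi_iff.1 h.measurable 0
    by_cases hij : i = j
    · subst hij
      simpa using h0
    · simp [hij]
  · obtain ⟨C, hC⟩ := h.bounded
    refine ⟨C, fun t ht i => ?_⟩
    by_cases hij : i = j
    · subst hij
      simpa using hC t ht 0
    · simpa [hij] using (abs_nonneg _).trans (hC t ht 0)
  · rw [h.eq_integral t ht]
    simp [cellSystem, Pi.single_apply, ite_smul]

/-- The projection of the system to the quotient by the center can be steered, and its trajectories
lift: the corner coordinate at the endpoint is an invertible affine function of the initial one. -/
theorem exists_steering_affine [Nonempty (Fin n)] (hS : S.RankCondition)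
    (w₀ w₁ : (Fin n → ℝ) × (Fin n → ℝ)) :
    ∃ a c : ℝ, a ≠ 0 ∧ ∀ z : ℝ,
      S.Steerable ⟨lift n w₀ + center n z⟩ ⟨lift n w₁ + center n (a * z + c)⟩ := by
  obtain ⟨l, hl⟩ := S.isLinear.exists_corner_center
  obtain ⟨u, hu, w, hw0, hw1, hw⟩ := exists_steering S.isLinear.quotientMap
    (fun i => proj n (S.B i)) hS.span_eq_top w₀ w₁
  have hwc : Continuous w := continuous_iff_continuousAt.2 fun t => (hw t).continuousAt
  -- The forcing term of the corner equation, computed along the lift with zero corner and so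
  -- independent of `z`.
  let r : ℝ → ℝ := fun t => corner n (S.velocity u (fun s => ⟨lift n (w s)⟩) t)
  have hr : Continuous r := by
    have hlw : Continuous fun s => lift n (w s) := (lift n).continuous.comp hwc
    refine (corner n).continuous.comp ((S.isLinear.continuous.comp hlw).add
      (continuous_finsetSum _ fun i _ => ?_))
    exact ((continuous_apply i).comp hu).smul
      (continuous_const.add ((prodL n (S.B i)).continuous.comp hlw))
  let c : ℝ → ℝ := fun t => Real.exp (l * t) * ∫ s in (0 : ℝ)..t, Real.exp (-(l * s)) * r s
  have hc : ∀ t, HasDerivAt c (l * c t + r t) t := by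
    intro t
    have h1 : HasDerivAt (fun t => Real.exp (l * t)) (Real.exp (l * t) * (l * 1)) t :=
      ((hasDerivAt_id t).const_mul l).exp
    have hcont : Continuous fun s => Real.exp (-(l * s)) * r s := by fun_prop
    refine (h1.mul (hcont.integral_hasStrictDerivAt 0 t).hasDerivAt).congr_deriv ?_
    have : Real.exp (l * t) * (Real.exp (-(l * t)) * r t) = r t := by
      rw [← mul_assoc, ← Real.exp_add, add_neg_cancel, Real.exp_zero, one_mul]
    rw [this]
    simp only [c]
    ring
  refine ⟨Real.exp (l * 1), c 1, (Real.exp_pos _).ne', fun z => ?_⟩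
  let ζ : ℝ → ℝ := fun t => Real.exp (l * t) * z + c t
  have hζ : ∀ t, HasDerivAt ζ (l * ζ t + r t) t := by
    intro t
    have h1 : HasDerivAt (fun t => Real.exp (l * t)) (Real.exp (l * t) * (l * 1)) t :=
      ((hasDerivAt_id t).const_mul l).exp
    refine ((h1.mul_const z).add (hc t)).congr_deriv ?_
    simp only [ζ]
    ring
  refine ⟨1, zero_le_one, u, fun t => ⟨lift n (w t) + center n (ζ t)⟩,
    isTrajectory_of_hasDerivAt 1 hu fun t => ?_, by simp [hw0, ζ, c], by simp only [hw1, ζ]⟩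
  have hd := ((lift n).hasFDerivAt.comp_hasDerivAt t (hw t)).add
    ((center n).hasFDerivAt.comp_hasDerivAt t (hζ t))
  refine hd.congr_deriv ?_
  set v := lift n (w t) + center n (ζ t) with hv
  have hpv : proj n v = w t := by simp [hv]
  have hcv : corner n v = ζ t := by simp [hv]
  rw [← lift_proj_add_center_corner (S.velocity u _ t)]
  congr 2
  · rw [velocity, map_add, ← hv, S.isLinear.proj_apply, hpv, map_sum]
    simp [Heis.rightInv]
  -- The right-invariant fields have a corner that reads only the projection of the point; the drift
  -- alone adds `l ζ`.
  · simp only [r]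
    rw [velocity, velocity, map_add, map_add, ← hv, S.isLinear.corner_apply hl v, hpv, hcv, map_sum,
      map_sum]
    simp [Heis.rightInv, hv]
    ring

theorem exists_steerable_center [Nonempty (Fin n)] (hS : S.RankCondition) (g : Heis n) :
    ∃ z, S.Steerable g ⟨center n z⟩ := by
  obtain ⟨a, c, -, h⟩ := S.exists_steering_affine hS (proj n g.G) 0
  refine ⟨a * corner n g.G + c, ?_⟩
  have := h (corner n g.G)
  rwa [lift_proj_add_center_corner, map_zero, zero_add] at this

/-- Here `a ≠ 0` is essential: the initial corner solves `a z + c = corner g`. -/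
theorem exists_center_steerable [Nonempty (Fin n)] (hS : S.RankCondition) (g : Heis n) :
    ∃ z, S.Steerable ⟨center n z⟩ g := by
  obtain ⟨a, c, ha, h⟩ := S.exists_steering_affine hS 0 (proj n g.G)
  refine ⟨(corner n g.G - c) / a, ?_⟩
  have := h ((corner n g.G - c) / a)
  rwa [mul_div_cancel₀ _ ha, sub_add_cancel, lift_proj_add_center_corner, map_zero,
    zero_add] at this

/-- If any two central elements can be steered to each other, the rank condition implies
controllability. -/
theorem controllable_of_steerable_center [Nonempty (Fin n)] (hS : S.RankCondition)
    (hc : ∀ z z' : ℝ, S.Steerable ⟨center n z⟩ ⟨center n z'⟩) : S.Controllable := by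
  intro g _ h _
  obtain ⟨z, hz⟩ := S.exists_steerable_center hS g
  obtain ⟨z', hz'⟩ := S.exists_center_steerable hS h
  obtain ⟨T, hT, u, γ, hγ, h0, h1⟩ := (hz.trans (hc z z')).trans hz'
  exact ⟨T, hT, u, γ, hγ, h0, h1, fun t _ => Subgroup.mem_top _⟩

end LinearSystem

/-! ### The center inside the cell subgroup, and the conclusion. -/

/-- `Z` is a bracket, hence has only a corner entry, and that entry is nonzero by linear
independence. -/
theorem IsSymplecticBasis.exists_eq_center {n : ℕ} {X Y : Fin n → HeisAlg n} {Z : HeisAlg n}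
    (h : IsSymplecticBasis X Y Z) (i : Fin n) : ∃ c : ℝ, c ≠ 0 ∧ Z = HeisAlg.center n c := by
  have hZ : Z = HeisAlg.center n Z.z := by
    have := HeisAlg.proj_lie (X i) (Y i)
    rw [h.lie_X_Y i, HeisAlg.proj_apply, Prod.mk_eq_zero] at this
    ext <;> simp [this]
  refine ⟨Z.z, fun h0 => ?_, hZ⟩
  have hne : Z ≠ 0 := h.linearIndependent.ne_zero (Sum.inr (Sum.inr ()))
  rw [h0, map_zero] at hZ
  exact hne hZ

end

theorem theorem8 {n m : ℕ} (hmn : m ≤ n) (S : LinearSystem n m)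
    (X Y : Fin n → HeisAlg n) (Z : HeisAlg n) (hbasis : IsSymplecticBasis X Y Z)
    (hXB : ∀ i : Fin m, X (Fin.castLE hmn i) = S.B i)
    (hrank : S.RankCondition)
    (j : Fin m)
    (hdec : S.CellDecoupled j (Y (Fin.castLE hmn j)) Z)
    (hcell : S.CellControllable j (Y (Fin.castLE hmn j)) Z) :
    S.Controllable := by
  have : Nonempty (Fin n) := ⟨Fin.castLE hmn j⟩
  obtain ⟨c, hc, hZ⟩ := hbasis.exists_eq_center (Fin.castLE hmn j)
  have hmem : ∀ z : ℝ, (⟨HeisAlg.center n z⟩ : Heis n) ∈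
      Heis.lieSubgroup {S.B j, Y (Fin.castLE hmn j), Z} := by
    intro z
    refine Subgroup.subset_closure ⟨HeisAlg.center n z, ?_, Heis.exp_center z⟩
    have hz : HeisAlg.center n z = (z / c) • Z := by
      rw [hZ, ← map_smul, smul_eq_mul, div_mul_cancel₀ _ hc]
    rw [hz]
    exact LieSubalgebra.smul_mem _ _ (LieSubalgebra.subset_lieSpan (by simp))
  refine LinearSystem.controllable_of_steerable_center hrank fun z z' => ?_
  obtain ⟨T, hT, u, γ, hγ, h0, h1, -⟩ := hcell _ (hmem z) _ (hmem z')
  exact ⟨T, hT, _, γ, hγ.of_cellSystem, h0, h1⟩
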